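/- Let $(\Omega,\mathcal F,P)$ be a probability space and let $(h_n)_{n\ge 1}$ be positive numbers such that $n h_n^{\kappa}\to 0$ for some $\kappa>0$. For $n\ge 1$ and $l\in\{1,2\}$ let $M_l=M_l^n$ be a random positive integer and let $0=S_0^{n,l}<S_1^{n,l}<\dots<S_{M_l}^{n,l}=nh_n$ be random times. Put $I_i^l=(S_{i-1}^{n,l},S_i^{n,l}]$ for $1\le i\le M_l$, $\mathfrak I_l=(|I_i^l|^{1/2})_{i=1}^{M_l}$, $$G=\Big(\frac{|I_i^1\cap I_j^2|}{|I_i^1|^{1/2}|I_j^2|^{1/2}}\Big)_{1\le i\le M_1,\,1\le j\le M_2},\qquad \mathcal N_t^{n,l}=\#\{1\le i\le M_l: S_i^{n,l}\le t\}.$$ Let $\mathfrak S$ be the set of sequences $0=s_0<s_1<\cdots$ with $\sup_{k\ge1}(s_k-s_{k-1})\le 1$ and $\inf_{k\ge1}(s_k-s_{k-1})>0$. For $(s_k)\in\mathfrak S$ let $q_n=\max\{k: s_k\le nh_n\}$ and let $\mathcal E_{(k)}^l$ be the diagonal $M_l\times M_l$ matrix whose $i$-th diagonal entry is $1$ if $S_i^{n,l}\in(s_{k-1},s_k]$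 and $0$ otherwise. A maximum over an empty index set is $0$. Assume that for every $q>0$: (B1-$q$) $\displaystyle\sup_{n\ge1}\max_{l\in\{1,2\}}\sup_{0\le t\le (n-1)h_n}E\big[(\mathcal N^{n,l}_{t+h_n}-\mathcal N^{n,l}_t)^q\big]<\infty$; (B2-$q$) $\displaystyle\limsup_{u\to\infty}\sup_{n\ge1}\max_{l\in\{1,2\}}\sup_{0\le t\le nh_n-uh_n}u^qP(\mathcal N^{n,l}_{t+uh_n}-\mathcal N^{n,l}_t=0)<\infty$ (suprema over empty sets being $0$); (mixing) $\displaystyle\sup_{n\ge1}\sum_{k=0}^\infty(k+1)^q\alpha_k^n<\infty$, where $\mathcal G^n_{i,j}=\sigma(\mathcal N^{n,l}_t-\mathcal N^{n,l}_s;\ ih_n\le s<t\le jh_n,\ l=1,2)$ and $$\alpha_k^n=0\vee\sup_{1\le i,j\le n-1,\ j-i\ge k}\ \sup_{A\in\mathcal G^n_{0,i}}\ \sup_{B\in\mathcal G^n_{j,n}}|P(A\cap B)-P(A)P(B)|.$$ Assume moreover that there are nonnegative constants $f_p^{1,1},f_p^{1,2},f_p^{2,2}$ ($p=0,1,2,\dots$)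 such that for all $p\ge 0$ and all $(s_k)\in\mathfrak S$, as $n\to\infty$, $$\max_{1\le k\le q_n}\big|E[\mathfrak I_1^\top\mathcal E_{(k)}^1(GG^\top)^p\mathfrak I_1]-f_p^{1,1}(s_k-s_{k-1})\big|\to0,$$ $$\max_{1\le k\le q_n}\big|E[\mathfrak I_1^\top\mathcal E_{(k)}^1(GG^\top)^pG\,\mathfrak I_2]-f_p^{1,2}(s_k-s_{k-1})\big|\to0,$$ $$\max_{1\le k\le q_n}\big|E[\mathfrak I_2^\top\mathcal E_{(k)}^2(G^\top G)^p\mathfrak I_2]-f_p^{2,2}(s_k-s_{k-1})\big|\to0.$$ Then Assumption (A5) holds, with the same constants: for all $p\ge0$ and all $(s_k)\in\mathfrak S$, $$\max_{1\le k\le q_n}\big|\mathfrak I_1^\top\mathcal E_{(k)}^1(GG^\top)^p\mathfrak I_1-f_p^{1,1}(s_k-s_{k-1})\big|\to0,$$ $$\max_{1\le k\le q_n}\big|\mathfrak I_1^\top\mathcal E_{(k)}^1(GG^\top)^pG\,\mathfrak I_2-f_p^{1,2}(s_k-s_{k-1})\big|\to0,$$ $$\max_{1\le k\le q_n}\big|\mathfrak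 I_2^\top\mathcal E_{(k)}^2(G^\top G)^p\mathfrak I_2-f_p^{2,2}(s_k-s_{k-1})\big|\to0$$ in probability as $n\to\infty$. -/

import Mathlib

open Filter Topology MeasureTheory
open scoped ENNReal NNReal Matrix

noncomputable section

namespace NonsyncObs

/-! ### Functionals of one realisation of the observation times

A realisation is a number `m` of intervals and times `t 0 < t 1 < ⋯ < t m`; the values `t i` with
`i > m` are never used.  The index `i : Fin m` stands for the interval `(t i, t (i + 1)]`. -/

/-- The matrix `G` with entries `|I_i ∩ J_j| / (|I_i|^{1/2} |J_j|^{1/2})`. -/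
def overlapMatrix (m₁ m₂ : ℕ) (t₁ t₂ : ℕ → ℝ) : Matrix (Fin m₁) (Fin m₂) ℝ :=
  Matrix.of fun i j =>
    max (min (t₁ (i + 1)) (t₂ (j + 1)) - max (t₁ i) (t₂ j)) 0 /
      (√(t₁ (i + 1) - t₁ i) * √(t₂ (j + 1) - t₂ j))

/-- The vector `(|I_i|^{1/2})_i`. -/
def sqrtLengths (m : ℕ) (t : ℕ → ℝ) : Fin m → ℝ :=
  fun i => √(t (i + 1) - t i)

/-- The diagonal 0-1 matrix selecting the intervals whose right end point lies in `(a, b]`. -/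
def blockMatrix (m : ℕ) (t : ℕ → ℝ) (a b : ℝ) : Matrix (Fin m) (Fin m) ℝ :=
  open Classical in Matrix.diagonal fun i => if t (i + 1) ∈ Set.Ioc a b then 1 else 0

/-- The number of indices `1 ≤ i ≤ m` with `t i ≤ x`. -/
def countUpTo (m : ℕ) (t : ℕ → ℝ) (x : ℝ) : ℕ :=
  open Classical in ((Finset.Icc 1 m).filter fun i => t i ≤ x).card

/-- The maximum of `|f k|` over `1 ≤ k ≤ q` (zero if `q = 0`). -/
def maxAbs (q : ℕ) (f : ℕ → ℝ) : ℝ :=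
  ((Finset.Icc 1 q).sup fun k => ‖f k‖₊ : ℝ≥0)

/-! ### Partitions of `[0, ∞)` -/

/-- Partitions `0 = s 0 < s 1 < ⋯` of `[0, ∞)` whose mesh is at most one and bounded below by a
positive number. -/
structure IsAdmissiblePartition (s : ℕ → ℝ) : Prop where
  zero : s 0 = 0
  mesh_le_one : ∀ k, s (k + 1) - s k ≤ 1
  exists_le_mesh : ∃ δ > 0, ∀ k, δ ≤ s (k + 1) - s k

/-- The largest `k` with `s k ≤ T`. -/
def lastIndex (s : ℕ → ℝ) (T : ℝ) : ℕ := sSup {k | s k ≤ T}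

/-! ### Random observation times -/

/-- For every `n ≥ 1` two families (`l = 0` and `l = 1`) of random observation times
`0 = S n l 0 < S n l 1 < ⋯ < S n l (M n l) = n * h n`, where `M n l` is a random positive integer.
The random variables `S n l i` on `{M n l < i}` are irrelevant. -/
structure SamplingScheme (Ω : Type*) [MeasurableSpace Ω] where
  h : ℕ → ℝ
  M : ℕ → Fin 2 → Ω → ℕ
  S : ℕ → Fin 2 → ℕ → Ω → ℝ
  h_pos : ∀ n, 1 ≤ n → 0 < h n
  measurable_M : ∀ n, 1 ≤ n → ∀ l, Measurable (M n l)
  measurable_S : ∀ n, 1 ≤ n → ∀ l i, Measurable (S n l i)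
  M_pos : ∀ n, 1 ≤ n → ∀ l ω, 0 < M n l ω
  S_zero : ∀ n, 1 ≤ n → ∀ l ω, S n l 0 ω = 0
  S_last : ∀ n, 1 ≤ n → ∀ l ω, S n l (M n l ω) ω = n * h n
  S_lt : ∀ n, 1 ≤ n → ∀ l ω, ∀ i < M n l ω, S n l i ω < S n l (i + 1) ω

namespace SamplingScheme

variable {Ω : Type*} [MeasurableSpace Ω] (𝒮 : SamplingScheme Ω)

/-- The matrix `G`. -/
def G (n : ℕ) (ω : Ω) : Matrix (Fin (𝒮.M n 0 ω)) (Fin (𝒮.M n 1 ω)) ℝ :=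
  overlapMatrix (𝒮.M n 0 ω) (𝒮.M n 1 ω) (fun i => 𝒮.S n 0 i ω) (fun j => 𝒮.S n 1 j ω)

/-- The vector `𝔍_l` of the square roots of the lengths of the observation intervals. -/
def J (n : ℕ) (l : Fin 2) (ω : Ω) : Fin (𝒮.M n l ω) → ℝ :=
  sqrtLengths (𝒮.M n l ω) (fun i => 𝒮.S n l i ω)

/-- The matrix `E_{(k)}^l` for the block `(s (k - 1), s k]` of a partition (`k ≥ 1`). -/
def E (n : ℕ) (l : Fin 2) (s : ℕ → ℝ) (k : ℕ) (ω : Ω) :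
    Matrix (Fin (𝒮.M n l ω)) (Fin (𝒮.M n l ω)) ℝ :=
  blockMatrix (𝒮.M n l ω) (fun i => 𝒮.S n l i ω) (s (k - 1)) (s k)

/-- `𝔍₁ᵀ E_{(k)}^1 (G Gᵀ)^p 𝔍₁`. -/
def form11 (n p : ℕ) (s : ℕ → ℝ) (k : ℕ) (ω : Ω) : ℝ :=
  𝒮.J n 0 ω ⬝ᵥ ((𝒮.E n 0 s k ω * (𝒮.G n ω * (𝒮.G n ω)ᵀ) ^ p) *ᵥ 𝒮.J n 0 ω)

/-- `𝔍₁ᵀ E_{(k)}^1 (G Gᵀ)^p G 𝔍₂`. -/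
def form12 (n p : ℕ) (s : ℕ → ℝ) (k : ℕ) (ω : Ω) : ℝ :=
  𝒮.J n 0 ω ⬝ᵥ ((𝒮.E n 0 s k ω * (𝒮.G n ω * (𝒮.G n ω)ᵀ) ^ p * 𝒮.G n ω) *ᵥ 𝒮.J n 1 ω)

/-- `𝔍₂ᵀ E_{(k)}^2 (Gᵀ G)^p 𝔍₂`. -/
def form22 (n p : ℕ) (s : ℕ → ℝ) (k : ℕ) (ω : Ω) : ℝ :=
  𝒮.J n 1 ω ⬝ᵥ ((𝒮.E n 1 s k ω * ((𝒮.G n ω)ᵀ * 𝒮.G n ω) ^ p) *ᵥ 𝒮.J n 1 ω)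

/-- `q_n`, the largest `k` with `s k ≤ n * h n`. -/
def q (s : ℕ → ℝ) (n : ℕ) : ℕ := lastIndex s (n * 𝒮.h n)

/-- The number `N^{n,l}_t` of observation times `S n l i`, `1 ≤ i ≤ M n l`, up to time `t`. -/
def N (n : ℕ) (l : Fin 2) (t : ℝ) (ω : Ω) : ℕ :=
  countUpTo (𝒮.M n l ω) (fun i => 𝒮.S n l i ω) t

/-- Condition (B1-r). -/
def B1 (P : Measure Ω) (r : ℝ) : Prop :=
  (⨆ (n : ℕ) (_ : 1 ≤ n) (l : Fin 2) (t : ℝ) (_ : t ∈ Set.Icc 0 (((n : ℝ) - 1) * 𝒮.h n)),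
    ∫⁻ ω, ((𝒮.N n l (t + 𝒮.h n) ω - 𝒮.N n l t ω : ℕ) : ℝ≥0∞) ^ r ∂P) < ∞

/-- Condition (B2-r); the supremum over an empty set of `(n, t)` is zero. -/
def B2 (P : Measure Ω) (r : ℝ) : Prop :=
  limsup (fun u : ℝ =>
    ⨆ (n : ℕ) (_ : 1 ≤ n) (l : Fin 2) (t : ℝ) (_ : t ∈ Set.Icc 0 (n * 𝒮.h n - u * 𝒮.h n)),
      ENNReal.ofReal (u ^ r) * P {ω | 𝒮.N n l (t + u * 𝒮.h n) ω - 𝒮.N n l t ω = 0}) atTop < ∞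

/-- The sigma-algebra generated by the increments `N^{n,l}_t - N^{n,l}_s`, where
`i * h n ≤ s < t ≤ j * h n` and `l` takes both values. -/
@[reducible] def incrementSigma (n i j : ℕ) : MeasurableSpace Ω :=
  ⨆ (l : Fin 2) (s : ℝ) (t : ℝ) (_ : i * 𝒮.h n ≤ s ∧ s < t ∧ t ≤ j * 𝒮.h n),
    MeasurableSpace.comap (fun ω => 𝒮.N n l t ω - 𝒮.N n l s ω) ⊤

/-- The mixing coefficient `α_k^n`: the supremum over `1 ≤ i, j ≤ n - 1` with `j - i ≥ k`
(zero if there are no such `i, j`). -/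
def mixingCoeff (P : Measure Ω) (n k : ℕ) : ℝ≥0∞ :=
  ⨆ (i : ℕ) (j : ℕ) (_ : 1 ≤ i ∧ i + k ≤ j ∧ j + 1 ≤ n)
    (A : Set Ω) (_ : MeasurableSet[𝒮.incrementSigma n 0 i] A)
    (B : Set Ω) (_ : MeasurableSet[𝒮.incrementSigma n j n] B),
      ENNReal.ofReal |P.real (A ∩ B) - P.real A * P.real B|

/-- The summability condition `sup_n ∑_k (k + 1)^r α_k^n < ∞`. -/
def SummableMixing (P : Measure Ω) (r : ℝ) : Prop :=
  (⨆ (n : ℕ) (_ : 1 ≤ n), ∑' k : ℕ, ((k : ℝ≥0∞) + 1) ^ r * 𝒮.mixingCoeff P n k) < ∞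

/-- The expectations of a family `X n s k` of functionals of the sampling scheme are
asymptotically `f * (s k - s (k - 1))`, uniformly in `1 ≤ k ≤ q_n`, for every partition. -/
def MeanLimit (P : Measure Ω) (X : ℕ → (ℕ → ℝ) → ℕ → Ω → ℝ) (f : ℝ) : Prop :=
  ∀ s : ℕ → ℝ, IsAdmissiblePartition s →
    Tendsto (fun n => maxAbs (𝒮.q s n) fun k => (∫ ω, X n s k ω ∂P) - f * (s k - s (k - 1)))
      atTop (𝓝 0)

/-- The random variables `X n s k` are asymptotically `f * (s k - s (k - 1))` in probability,
uniformly in `1 ≤ k ≤ q_n`, for every partition. -/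
def ProbLimit (P : Measure Ω) (X : ℕ → (ℕ → ℝ) → ℕ → Ω → ℝ) (f : ℝ) : Prop :=
  ∀ s : ℕ → ℝ, IsAdmissiblePartition s →
    TendstoInMeasure P (fun n ω => maxAbs (𝒮.q s n) fun k => X n s k ω - f * (s k - s (k - 1)))
      atTop (fun _ => 0)

/-- Assumption (A5), with the limit constants made explicit. -/
structure A5 (P : Measure Ω) (f11 f12 f22 : ℕ → ℝ) : Prop where
  nonneg11 : ∀ p, 0 ≤ f11 p
  nonneg12 : ∀ p, 0 ≤ f12 p
  nonneg22 : ∀ p, 0 ≤ f22 p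
  lim11 : ∀ p, 𝒮.ProbLimit P (fun n => 𝒮.form11 n p) (f11 p)
  lim12 : ∀ p, 𝒮.ProbLimit P (fun n => 𝒮.form12 n p) (f12 p)
  lim22 : ∀ p, 𝒮.ProbLimit P (fun n => 𝒮.form22 n p) (f22 p)

end SamplingScheme

end NonsyncObs

end

/-!
The observation intervals of each of the two families tile `(0, n h_n]`.  Therefore
`∑ j, |I_i ∩ J_j| = |I_i|`, which says that `G 𝔍₂ = 𝔍₁` and, by symmetry, `Gᵀ 𝔍₁ = 𝔍₂`
(`overlapMatrix_mulVec_sqrtLengths`).  All powers of `G Gᵀ` and `Gᵀ G` thus disappear from the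
quadratic forms, and each form is the total length of those intervals of one family whose right
end point lies in the block `(s (k - 1), s k]` (`blockLength`).  This total length telescopes, and it
differs from `s k - s (k - 1)` by at most the longest interval (`abs_blockLength_sub_le`).

An interval longer than `2 w` contains a cell of the grid of width `w` without an observation.  By
(B2) such a cell has probability `O((h_n / w) ^ κ)`, and there are `O(n)` cells, so that
`n h_n ^ κ → 0` makes the longest interval tend to zero in probability (`tendsto_measure_longGap`).
Hence the forms are asymptotically `s k - s (k - 1)`, uniformly in `k`, in probability.  The form
of the first block lies in `[0, 1]`, so its mean has the same limit (`eq_one_of_meanLimit`).  The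
limit constant is therefore `1`, unless `q_n = 0` for all large `n`; then the maxima are over empty
sets and there is nothing to show.
-/

namespace NonsyncObs

/-! ### Subdivisions of an interval -/

/-- The numbers `t 0 < ⋯ < t m` subdivide `[0, T]`; the values `t i` with `i > m` are arbitrary. -/
structure IsSubdivision (m : ℕ) (t : ℕ → ℝ) (T : ℝ) : Prop where
  zero : t 0 = 0
  last : t m = T
  lt : ∀ i < m, t i < t (i + 1)

/-- The total length of the intervals `(t i, t (i + 1)]`, `i < m`, whose right end point lies in
`(a, b]`. -/
noncomputable def blockLength (m : ℕ) (t : ℕ → ℝ) (a b : ℝ) : ℝ :=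
  open Classical in
  ∑ i ∈ Finset.range m, if t (i + 1) ∈ Set.Ioc a b then t (i + 1) - t i else 0

theorem IsSubdivision.monotone {m : ℕ} {t : ℕ → ℝ} {T : ℝ} (h : IsSubdivision m t T) {i j : ℕ}
    (hij : i ≤ j) (hj : j ≤ m) : t i ≤ t j := by
  induction j, hij using Nat.le_induction with
  | base => exact le_rfl
  | succ j _ ih => exact (ih (by omega)).trans (h.lt j (by omega)).le

theorem IsSubdivision.nonneg {m : ℕ} {t : ℕ → ℝ} {T : ℝ} (h : IsSubdivision m t T) {i : ℕ}
    (hi : i ≤ m) : 0 ≤ t i :=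
  h.zero ▸ h.monotone (Nat.zero_le i) hi

theorem IsSubdivision.le_last {m : ℕ} {t : ℕ → ℝ} {T : ℝ} (h : IsSubdivision m t T) {i : ℕ}
    (hi : i ≤ m) : t i ≤ T :=
  h.last ▸ h.monotone hi le_rfl

/-- The length of `(a, a'] ∩ (b, b']` is the increment over `(b, b']` of the projection onto
`[a, a']`; this makes sums of lengths of intersections telescope. -/
theorem max_min_sub_max_eq {a a' b b' : ℝ} (ha : a ≤ a') (hb : b ≤ b') :
    max (min a' b' - max a b) 0 = max a (min a' b') - max a (min a' b) := by
  rcases le_total a' b' with h1 | h1 <;> rcases le_total a' b with h2 | h2 <;>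
    rcases le_total a b with h3 | h3 <;> rcases le_total a b' with h4 | h4 <;>
    simp only [min_eq_left, min_eq_right, max_eq_left, max_eq_right, h1, h2, h3, h4, ha] <;>
    first
      | (rw [max_eq_left] <;> linarith)
      | (rw [max_eq_right] <;> linarith)

theorem IsSubdivision.sum_overlap {m : ℕ} {t : ℕ → ℝ} {T : ℝ} (h : IsSubdivision m t T)
    {a a' : ℝ} (ha : 0 ≤ a) (haa' : a ≤ a') (ha' : a' ≤ T) :
    ∑ j : Fin m, max (min a' (t (j + 1)) - max a (t j)) 0 = a' - a := by
  rw [Finset.sum_congr rfl fun (j : Fin m) _ => max_min_sub_max_eq haa' (h.lt j.1 j.2).le,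
    Fin.sum_univ_eq_sum_range (fun j => max a (min a' (t (j + 1))) - max a (min a' (t j))),
    Finset.sum_range_sub (fun j => max a (min a' (t j))), h.last, h.zero, min_eq_left ha',
    min_eq_right (ha.trans haa'), max_eq_right haa', max_eq_left ha]

/-! ### The action of the overlap matrix on the square roots of the lengths -/

/-- `G 𝔍₂ = 𝔍₁`: the second family covers every interval of the first. -/
theorem overlapMatrix_mulVec_sqrtLengths {m₁ m₂ : ℕ} {t₁ t₂ : ℕ → ℝ} {T : ℝ}
    (h₁ : IsSubdivision m₁ t₁ T) (h₂ : IsSubdivision m₂ t₂ T) :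
    overlapMatrix m₁ m₂ t₁ t₂ *ᵥ sqrtLengths m₂ t₂ = sqrtLengths m₁ t₁ := by
  ext i
  have hi := h₁.lt i i.2
  have hterm : ∀ j : Fin m₂, overlapMatrix m₁ m₂ t₁ t₂ i j * sqrtLengths m₂ t₂ j =
      max (min (t₁ (i + 1)) (t₂ (j + 1)) - max (t₁ i) (t₂ j)) 0 / √(t₁ (i + 1) - t₁ i) := by
    intro j
    have hj : √(t₂ (j + 1) - t₂ j) ≠ 0 := (Real.sqrt_pos.2 (sub_pos.2 (h₂.lt j j.2))).ne'
    simp only [overlapMatrix, sqrtLengths, Matrix.of_apply]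
    field_simp
  simp only [Matrix.mulVec, dotProduct]
  rw [Finset.sum_congr rfl fun j _ => hterm j, ← Finset.sum_div,
    h₂.sum_overlap (h₁.nonneg i.2.le) hi.le (h₁.le_last i.2), Real.div_sqrt]
  rfl

theorem overlapMatrix_transpose (m₁ m₂ : ℕ) (t₁ t₂ : ℕ → ℝ) :
    (overlapMatrix m₁ m₂ t₁ t₂)ᵀ = overlapMatrix m₂ m₁ t₂ t₁ := by
  ext i j
  simp only [overlapMatrix, Matrix.transpose_apply, Matrix.of_apply]
  rw [min_comm, max_comm (t₁ _), mul_comm]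

theorem pow_mulVec_eq_self {ι : Type*} [Fintype ι] [DecidableEq ι] {A : Matrix ι ι ℝ} {v : ι → ℝ}
    (h : A *ᵥ v = v) (p : ℕ) : A ^ p *ᵥ v = v := by
  induction p with
  | zero => simp
  | succ p ih => rw [pow_succ, ← Matrix.mulVec_mulVec, h, ih]

theorem sqrtLengths_dotProduct_blockMatrix {m : ℕ} {t : ℕ → ℝ} {T : ℝ} (h : IsSubdivision m t T)
    (a b : ℝ) :
    sqrtLengths m t ⬝ᵥ (blockMatrix m t a b *ᵥ sqrtLengths m t) = blockLength m t a b := by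
  classical
  rw [blockLength, ← Fin.sum_univ_eq_sum_range
    (fun i => if t (i + 1) ∈ Set.Ioc a b then t (i + 1) - t i else 0)]
  simp only [dotProduct]
  refine Finset.sum_congr rfl fun i _ => ?_
  rw [blockMatrix, Matrix.mulVec_diagonal]
  split_ifs with hi
  · rw [one_mul]
    exact Real.mul_self_sqrt (sub_nonneg.2 (h.lt i i.2).le)
  · simp

/-! ### The total length of the intervals in a block -/

/-- The intervals ending in `(-∞, x]` are those up to the last point `t j ≤ x`. -/
theorem sum_range_ite_le_eq {t : ℕ → ℝ} (h0 : t 0 = 0) (x : ℝ) (hx : 0 ≤ x) (m : ℕ)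
    (hlt : ∀ i < m, t i < t (i + 1)) :
    (t m ≤ x ∧ ∑ i ∈ Finset.range m, (if t (i + 1) ≤ x then t (i + 1) - t i else 0) = t m) ∨
      ∃ j < m, t j ≤ x ∧ x < t (j + 1) ∧
        ∑ i ∈ Finset.range m, (if t (i + 1) ≤ x then t (i + 1) - t i else 0) = t j := by
  induction m with
  | zero => left; simp [h0, hx]
  | succ m ih =>
    have hm := hlt m (by omega)
    rw [Finset.sum_range_succ]
    rcases ih fun i hi => hlt i (by omega) with ⟨h1, h2⟩ | ⟨j, hj, h1, h2, h3⟩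
    · rw [h2]
      by_cases hx' : t (m + 1) ≤ x
      · left; simp [hx']
      · right; exact ⟨m, by omega, h1, not_le.1 hx', by simp [hx']⟩
    · right
      have hjm : t (j + 1) ≤ t m :=
        (IsSubdivision.mk h0 rfl fun i hi => hlt i (by omega) :
          IsSubdivision m t (t m)).monotone hj le_rfl
      exact ⟨j, by omega, h1, h2, by rw [h3, if_neg (by linarith), add_zero]⟩

theorem IsSubdivision.sum_ite_le_mem_Icc {m : ℕ} {t : ℕ → ℝ} {T : ℝ} (h : IsSubdivision m t T)
    {g x : ℝ} (hg : ∀ i < m, t (i + 1) - t i ≤ g) (hg0 : 0 ≤ g) (hx : 0 ≤ x) (hxT : x ≤ T) :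
    ∑ i ∈ Finset.range m, (if t (i + 1) ≤ x then t (i + 1) - t i else 0) ∈
      Set.Icc (x - g) x := by
  have hT := h.last
  rcases sum_range_ite_le_eq h.zero x hx m h.lt with ⟨h1, h2⟩ | ⟨j, hj, h1, h2, h3⟩
  · rw [h2]; constructor <;> linarith
  · rw [h3]; have := hg j hj; constructor <;> linarith

theorem blockLength_eq_sub (m : ℕ) (t : ℕ → ℝ) {a b : ℝ} (hab : a ≤ b) :
    blockLength m t a b =
      ∑ i ∈ Finset.range m, (if t (i + 1) ≤ b then t (i + 1) - t i else 0) -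
        ∑ i ∈ Finset.range m, (if t (i + 1) ≤ a then t (i + 1) - t i else 0) := by
  rw [blockLength, ← Finset.sum_sub_distrib]
  refine Finset.sum_congr rfl fun i _ => ?_
  simp only [Set.mem_Ioc]
  rcases le_or_gt (t (i + 1)) a with h1 | h1
  · simp [h1.not_gt, h1, h1.trans hab]
  · simp [h1, h1.not_ge]

/-- The total length of the intervals ending in `(a, b]` is `b - a` up to the mesh: the intervals
cut by `a` and by `b` contribute errors of opposite sign. -/
theorem IsSubdivision.abs_blockLength_sub_le {m : ℕ} {t : ℕ → ℝ} {T : ℝ}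
    (h : IsSubdivision m t T) {g a b : ℝ} (hg : ∀ i < m, t (i + 1) - t i ≤ g) (hg0 : 0 ≤ g)
    (ha : 0 ≤ a) (hab : a ≤ b) (hb : b ≤ T) :
    |blockLength m t a b - (b - a)| ≤ g := by
  have hA := h.sum_ite_le_mem_Icc hg hg0 ha (hab.trans hb)
  have hB := h.sum_ite_le_mem_Icc hg hg0 (ha.trans hab) hb
  rw [blockLength_eq_sub m t hab, abs_le]
  constructor <;> linarith [hA.1, hA.2, hB.1, hB.2]

theorem IsSubdivision.blockLength_zero_mem_Icc {m : ℕ} {t : ℕ → ℝ} {T : ℝ}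
    (h : IsSubdivision m t T) {b : ℝ} (hb : 0 ≤ b) :
    blockLength m t 0 b ∈ Set.Icc 0 b := by
  have hnn : ∀ x : ℝ, ∀ i ∈ Finset.range m,
      0 ≤ if t (i + 1) ∈ Set.Ioc 0 x then t (i + 1) - t i else 0 := by
    intro x i hi
    have := h.lt i (Finset.mem_range.1 hi)
    split_ifs <;> linarith
  refine ⟨by classical exact Finset.sum_nonneg (by simpa using hnn b), ?_⟩
  have h0 : ∑ i ∈ Finset.range m, (if t (i + 1) ≤ 0 then t (i + 1) - t i else 0) = 0 := by
    refine Finset.sum_eq_zero fun i hi => if_neg ?_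
    have hi := Finset.mem_range.1 hi
    have := h.lt i hi
    have := h.nonneg hi.le
    linarith
  rw [blockLength_eq_sub m t hb, h0, sub_zero]
  rcases sum_range_ite_le_eq h.zero b hb m h.lt with ⟨h1, h2⟩ | ⟨j, hj, h1, h2, h3⟩
  · rw [h2]; exact h1
  · rw [h3]; exact h1

/-! ### Long intervals contain empty grid cells -/

theorem IsSubdivision.countUpTo_eq {m : ℕ} {t : ℕ → ℝ} {T : ℝ} (h : IsSubdivision m t T)
    {j : ℕ} (hj : j < m) {x : ℝ} (h1 : t j ≤ x) (h2 : x < t (j + 1)) : countUpTo m t x = j := by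
  classical
  have hset : (Finset.Icc 1 m).filter (fun i => t i ≤ x) = Finset.Icc 1 j := by
    ext i
    simp only [Finset.mem_filter, Finset.mem_Icc]
    constructor
    · rintro ⟨⟨hi1, hi⟩, hix⟩
      refine ⟨hi1, ?_⟩
      by_contra! hji
      have := h.monotone (Nat.succ_le_of_lt hji) hi
      simp only [Nat.succ_eq_add_one] at this
      linarith
    · rintro ⟨hi1, hi⟩
      exact ⟨⟨hi1, by omega⟩, (h.monotone hi hj.le).trans h1⟩
  have : countUpTo m t x = (Finset.Icc 1 j).card := by
    rw [← hset, countUpTo]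
  simpa using this

theorem IsSubdivision.exists_empty_cell {m : ℕ} {t : ℕ → ℝ} {T w : ℝ} (h : IsSubdivision m t T)
    (hw : 0 < w) {j : ℕ} (hj : j < m) (hlong : 2 * w < t (j + 1) - t j) :
    ∃ c : ℕ, c * w + w ≤ T ∧ countUpTo m t (c * w + w) - countUpTo m t (c * w) = 0 := by
  -- the first grid point to the right of `t j`
  refine ⟨⌈t j / w⌉₊, ?_⟩
  have h0 := h.nonneg hj.le
  have h1 : t j ≤ ⌈t j / w⌉₊ * w := (div_le_iff₀ hw).1 (Nat.le_ceil _)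
  have h2 : ⌈t j / w⌉₊ * w < t j + w := by
    have := mul_lt_mul_of_pos_right (Nat.ceil_lt_add_one (div_nonneg h0 hw.le)) hw
    rwa [add_mul, div_mul_cancel₀ _ hw.ne', one_mul] at this
  have h3 := h.le_last hj
  refine ⟨by linarith, ?_⟩
  rw [h.countUpTo_eq hj (by linarith) (by linarith), h.countUpTo_eq hj h1 (by linarith),
    Nat.sub_self]

/-! ### Partitions and maxima over blocks -/

theorem IsAdmissiblePartition.strictMono {s : ℕ → ℝ} (hs : IsAdmissiblePartition s) :
    StrictMono s := by
  obtain ⟨δ, hδ, h⟩ := hs.exists_le_mesh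
  exact strictMono_nat_of_lt_succ fun k => by linarith [h k]

theorem IsAdmissiblePartition.nonneg {s : ℕ → ℝ} (hs : IsAdmissiblePartition s) (k : ℕ) :
    0 ≤ s k :=
  hs.zero ▸ hs.strictMono.monotone (Nat.zero_le k)

theorem IsAdmissiblePartition.le_of_le_lastIndex {s : ℕ → ℝ} (hs : IsAdmissiblePartition s)
    {T : ℝ} (hT : 0 ≤ T) {k : ℕ} (hk : k ≤ lastIndex s T) : s k ≤ T := by
  obtain ⟨δ, hδ, h⟩ := hs.exists_le_mesh
  have hlin : ∀ k : ℕ, k * δ ≤ s k := by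
    intro k
    induction k with
    | zero => simp [hs.zero]
    | succ k ih => push_cast; linarith [h k]
  have hbdd : BddAbove {k | s k ≤ T} := by
    refine ⟨⌈T / δ⌉₊, fun k hk => ?_⟩
    have h1 : (k : ℝ) ≤ T / δ := (le_div_iff₀ hδ).2 ((hlin k).trans hk)
    exact_mod_cast h1.trans (Nat.le_ceil _)
  exact (hs.strictMono.monotone hk).trans (Nat.sSup_mem ⟨0, by simpa [hs.zero] using hT⟩ hbdd)

theorem maxAbs_nonneg (q : ℕ) (f : ℕ → ℝ) : 0 ≤ maxAbs q f := NNReal.coe_nonneg _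

theorem abs_le_maxAbs {q k : ℕ} (f : ℕ → ℝ) (hk : k ∈ Finset.Icc 1 q) : |f k| ≤ maxAbs q f := by
  have : ‖f k‖₊ ≤ (Finset.Icc 1 q).sup fun k => ‖f k‖₊ :=
    Finset.le_sup (f := fun k => ‖f k‖₊) hk
  exact_mod_cast this

theorem maxAbs_le {q : ℕ} {f : ℕ → ℝ} {c : ℝ} (hc : 0 ≤ c)
    (h : ∀ k ∈ Finset.Icc 1 q, |f k| ≤ c) : maxAbs q f ≤ c := by
  lift c to ℝ≥0 using hc
  exact NNReal.coe_le_coe.2 (Finset.sup_le fun k hk => by exact_mod_cast h k hk)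

/-! ### The forms of a sampling scheme -/

namespace SamplingScheme

variable {Ω : Type*} [MeasurableSpace Ω] (𝒮 : SamplingScheme Ω)

theorem isSubdivision {n : ℕ} (hn : 1 ≤ n) (l : Fin 2) (ω : Ω) :
    IsSubdivision (𝒮.M n l ω) (fun i => 𝒮.S n l i ω) (n * 𝒮.h n) :=
  ⟨𝒮.S_zero n hn l ω, 𝒮.S_last n hn l ω, 𝒮.S_lt n hn l ω⟩

theorem horizon_nonneg {n : ℕ} (hn : 1 ≤ n) : 0 ≤ n * 𝒮.h n :=
  mul_nonneg n.cast_nonneg (𝒮.h_pos n hn).le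

/-- The total length of the intervals of the family `l` ending in `(s (k - 1), s k]`. -/
noncomputable def lengthIn (l : Fin 2) (n : ℕ) (s : ℕ → ℝ) (k : ℕ) (ω : Ω) : ℝ :=
  blockLength (𝒮.M n l ω) (fun i => 𝒮.S n l i ω) (s (k - 1)) (s k)

theorem G_mulVec_J {n : ℕ} (hn : 1 ≤ n) (ω : Ω) : 𝒮.G n ω *ᵥ 𝒮.J n 1 ω = 𝒮.J n 0 ω :=
  overlapMatrix_mulVec_sqrtLengths (𝒮.isSubdivision hn 0 ω) (𝒮.isSubdivision hn 1 ω)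

theorem G_transpose_mulVec_J {n : ℕ} (hn : 1 ≤ n) (ω : Ω) :
    (𝒮.G n ω)ᵀ *ᵥ 𝒮.J n 0 ω = 𝒮.J n 1 ω := by
  rw [G, overlapMatrix_transpose]
  exact overlapMatrix_mulVec_sqrtLengths (𝒮.isSubdivision hn 1 ω) (𝒮.isSubdivision hn 0 ω)

theorem J_dotProduct_E_mulVec_J {n : ℕ} (hn : 1 ≤ n) (l : Fin 2) (s : ℕ → ℝ) (k : ℕ) (ω : Ω) :
    𝒮.J n l ω ⬝ᵥ (𝒮.E n l s k ω *ᵥ 𝒮.J n l ω) = 𝒮.lengthIn l n s k ω :=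
  sqrtLengths_dotProduct_blockMatrix (𝒮.isSubdivision hn l ω) _ _

theorem form11_eq {n : ℕ} (hn : 1 ≤ n) (p : ℕ) (s : ℕ → ℝ) (k : ℕ) (ω : Ω) :
    𝒮.form11 n p s k ω = 𝒮.lengthIn 0 n s k ω := by
  rw [form11, ← Matrix.mulVec_mulVec, pow_mulVec_eq_self, 𝒮.J_dotProduct_E_mulVec_J hn]
  rw [← Matrix.mulVec_mulVec, 𝒮.G_transpose_mulVec_J hn, 𝒮.G_mulVec_J hn]

theorem form12_eq {n : ℕ} (hn : 1 ≤ n) (p : ℕ) (s : ℕ → ℝ) (k : ℕ) (ω : Ω) :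
    𝒮.form12 n p s k ω = 𝒮.lengthIn 0 n s k ω := by
  rw [form12, ← Matrix.mulVec_mulVec, 𝒮.G_mulVec_J hn]
  exact 𝒮.form11_eq hn p s k ω

theorem form22_eq {n : ℕ} (hn : 1 ≤ n) (p : ℕ) (s : ℕ → ℝ) (k : ℕ) (ω : Ω) :
    𝒮.form22 n p s k ω = 𝒮.lengthIn 1 n s k ω := by
  rw [form22, ← Matrix.mulVec_mulVec, pow_mulVec_eq_self, 𝒮.J_dotProduct_E_mulVec_J hn]
  rw [← Matrix.mulVec_mulVec, 𝒮.G_mulVec_J hn, 𝒮.G_transpose_mulVec_J hn]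

theorem measurable_lengthIn (l : Fin 2) {n : ℕ} (hn : 1 ≤ n) (s : ℕ → ℝ) (k : ℕ) :
    Measurable (𝒮.lengthIn l n s k) := by
  classical
  have hpair : Measurable fun x : ℕ × Ω =>
      blockLength x.1 (fun i => 𝒮.S n l i x.2) (s (k - 1)) (s k) := by
    refine measurable_from_prod_countable_right fun m => ?_
    simp only [blockLength]
    refine Finset.measurable_fun_sum _ fun i _ => Measurable.ite ?_ ?_ measurable_const
    · exact 𝒮.measurable_S n hn l (i + 1) measurableSet_Ioc
    · exact (𝒮.measurable_S n hn l (i + 1)).sub (𝒮.measurable_S n hn l i)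
  exact hpair.comp ((𝒮.measurable_M n hn l).prodMk measurable_id)

/-! ### The longest interval tends to zero in probability -/

/-- The event that the family `l` has an interval longer than `g`. -/
def longGap (n : ℕ) (l : Fin 2) (g : ℝ) : Set Ω :=
  {ω | ∃ i < 𝒮.M n l ω, g < 𝒮.S n l (i + 1) ω - 𝒮.S n l i ω}

theorem abs_lengthIn_sub_le {n : ℕ} (hn : 1 ≤ n) (l : Fin 2) {s : ℕ → ℝ}
    (hs : IsAdmissiblePartition s) {k : ℕ} (hk : k ∈ Finset.Icc 1 (𝒮.q s n)) {g : ℝ} (hg : 0 ≤ g)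
    {ω : Ω} (hω : ω ∉ 𝒮.longGap n l g) :
    |𝒮.lengthIn l n s k ω - (s k - s (k - 1))| ≤ g := by
  simp only [longGap, Set.mem_ofPred_eq, not_exists, not_and, not_lt] at hω
  exact (𝒮.isSubdivision hn l ω).abs_blockLength_sub_le hω hg (hs.nonneg _)
    (hs.strictMono.monotone (Nat.sub_le k 1))
    (hs.le_of_le_lastIndex (𝒮.horizon_nonneg hn) (Finset.mem_Icc.1 hk).2)

theorem tendsto_h {κ : ℝ} (hκ : 0 < κ)
    (hh : Tendsto (fun n : ℕ => (n : ℝ) * 𝒮.h n ^ κ) atTop (𝓝 0)) :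
    Tendsto 𝒮.h atTop (𝓝 0) := by
  have h1 : Tendsto (fun n => 𝒮.h n ^ κ) atTop (𝓝 0) := by
    refine squeeze_zero' ?_ ?_ hh
    · filter_upwards [eventually_ge_atTop 1] with n hn
      exact Real.rpow_nonneg (𝒮.h_pos n hn).le _
    · filter_upwards [eventually_ge_atTop 1] with n hn
      exact le_mul_of_one_le_left (Real.rpow_nonneg (𝒮.h_pos n hn).le _) (by exact_mod_cast hn)
  have h2 := h1.rpow_const (p := κ⁻¹) (Or.inr (inv_nonneg.2 hκ.le))
  rw [Real.zero_rpow (inv_ne_zero hκ.ne')] at h2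
  refine h2.congr' ?_
  filter_upwards [eventually_ge_atTop 1] with n hn
  exact Real.rpow_rpow_inv (𝒮.h_pos n hn).le hκ.ne'

theorem exists_measure_empty_cell_le {P : Measure Ω} {r : ℝ} (hB2 : 𝒮.B2 P r) :
    ∃ C : ℝ≥0∞, C ≠ ∞ ∧ ∀ᶠ u : ℝ in atTop, ∀ n, 1 ≤ n → ∀ l,
      ∀ t ∈ Set.Icc 0 (n * 𝒮.h n - u * 𝒮.h n),
        P {ω | 𝒮.N n l (t + u * 𝒮.h n) ω - 𝒮.N n l t ω = 0} ≤ C * ENNReal.ofReal (u⁻¹ ^ r) := by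
  obtain ⟨C, hC1, hC2⟩ := exists_between hB2
  refine ⟨C, hC2.ne, ?_⟩
  filter_upwards [eventually_lt_of_limsup_lt hC1, eventually_gt_atTop 0] with u hu hu0 n hn l t ht
  have hle : ENNReal.ofReal (u ^ r) * P {ω | 𝒮.N n l (t + u * 𝒮.h n) ω - 𝒮.N n l t ω = 0} ≤ C := by
    refine le_trans ?_ hu.le
    refine le_iSup₂_of_le n hn (le_iSup_of_le l ?_)
    exact le_iSup₂_of_le (f := fun t (_ : t ∈ Set.Icc 0 (n * 𝒮.h n - u * 𝒮.h n)) =>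
      ENNReal.ofReal (u ^ r) * P {ω | 𝒮.N n l (t + u * 𝒮.h n) ω - 𝒮.N n l t ω = 0}) t ht le_rfl
  have hpos : 0 < u ^ r := Real.rpow_pos_of_pos hu0 r
  rw [Real.inv_rpow hu0.le, ENNReal.ofReal_inv_of_pos hpos, ← div_eq_mul_inv,
    ENNReal.le_div_iff_mul_le (Or.inl (by simpa using hpos)) (Or.inl ENNReal.ofReal_ne_top),
    mul_comm]
  exact hle

/-- An interval longer than `2 w` contains one of at most `n` cells of width `w` (once `h n ≤ w`),
each of which is empty with probability `O((h n / w) ^ κ)`. -/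
theorem tendsto_measure_longGap {P : Measure Ω} {κ : ℝ} (hκ : 0 < κ)
    (hh : Tendsto (fun n : ℕ => (n : ℝ) * 𝒮.h n ^ κ) atTop (𝓝 0)) (hB2 : 𝒮.B2 P κ)
    (l : Fin 2) {g : ℝ} (hg : 0 < g) :
    Tendsto (fun n => P (𝒮.longGap n l g)) atTop (𝓝 0) := by
  obtain ⟨C, hC, hu⟩ := 𝒮.exists_measure_empty_cell_le hB2
  set w := g / 2 with hw_def
  have hw : 0 < w := half_pos hg
  have hh0 := 𝒮.tendsto_h hκ hh
  have hutop : Tendsto (fun n => w / 𝒮.h n) atTop atTop := by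
    simp only [div_eq_mul_inv]
    refine (Tendsto.inv_tendsto_nhdsGT_zero ?_).const_mul_atTop hw
    refine tendsto_nhdsWithin_iff.2 ⟨hh0, ?_⟩
    filter_upwards [eventually_ge_atTop 1] with n hn using 𝒮.h_pos n hn
  have hlim : Tendsto (fun n : ℕ => C * ENNReal.ofReal ((n : ℝ) * 𝒮.h n ^ κ * (w ^ κ)⁻¹))
      atTop (𝓝 0) := by
    have := ENNReal.tendsto_ofReal (hh.mul_const (w ^ κ)⁻¹)
    simpa using ENNReal.Tendsto.const_mul this (Or.inr hC)
  refine tendsto_of_tendsto_of_tendsto_of_le_of_le' tendsto_const_nhds hlim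
    (Eventually.of_forall fun _ => zero_le) ?_
  filter_upwards [eventually_ge_atTop 1, hutop.eventually hu, hh0.eventually_le_const hw]
    with n hn hcell hhw
  have hpos := 𝒮.h_pos n hn
  have hwh : w / 𝒮.h n * 𝒮.h n = w := div_mul_cancel₀ _ hpos.ne'
  replace hcell := hcell n hn l
  rw [hwh] at hcell
  have hsub : 𝒮.longGap n l g ⊆ ⋃ c ∈ Finset.range n, {ω | (c : ℝ) * w + w ≤ n * 𝒮.h n ∧
      𝒮.N n l (c * w + w) ω - 𝒮.N n l (c * w) ω = 0} := by
    rintro ω ⟨j, hj, hlong⟩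
    obtain ⟨c, hc, hN⟩ := (𝒮.isSubdivision hn l ω).exists_empty_cell hw hj
      (by rw [hw_def]; linarith)
    simp only [Set.mem_iUnion, Finset.mem_range]
    refine ⟨c, ?_, hc, hN⟩
    have : ((c : ℝ) + 1) * w ≤ n * w := by nlinarith [mul_le_mul_of_nonneg_left hhw n.cast_nonneg]
    have := le_of_mul_le_mul_right this hw
    exact_mod_cast this
  calc P (𝒮.longGap n l g)
      ≤ ∑ c ∈ Finset.range n, P {ω | (c : ℝ) * w + w ≤ n * 𝒮.h n ∧
          𝒮.N n l (c * w + w) ω - 𝒮.N n l (c * w) ω = 0} :=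
        (measure_mono hsub).trans (measure_biUnion_finset_le _ _)
    _ ≤ ∑ c ∈ Finset.range n, C * ENNReal.ofReal ((w / 𝒮.h n)⁻¹ ^ κ) := by
        refine Finset.sum_le_sum fun c _ => ?_
        by_cases hc : (c : ℝ) * w + w ≤ n * 𝒮.h n
        · refine (measure_mono fun ω hω => hω.2).trans (hcell _ ⟨by positivity, ?_⟩)
          linarith
        · simp [hc]
    _ = C * ENNReal.ofReal ((n : ℝ) * 𝒮.h n ^ κ * (w ^ κ)⁻¹) := by
        rw [Finset.sum_const, Finset.card_range, nsmul_eq_mul, mul_left_comm,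
          ← ENNReal.ofReal_natCast, ← ENNReal.ofReal_mul n.cast_nonneg, inv_div,
          Real.div_rpow hpos.le hw.le, div_eq_mul_inv, mul_assoc (n : ℝ)]

/-! ### From limits of means to limits in probability -/

theorem abs_integral_le_add_measureReal {P : Measure Ω} [IsProbabilityMeasure P] {Y : Ω → ℝ}
    (hY : Measurable Y) (hY1 : ∀ ω, |Y ω| ≤ 1) {ε : ℝ} (hε : 0 ≤ ε) :
    |∫ ω, Y ω ∂P| ≤ ε + P.real {ω | ε < |Y ω|} := by
  have hD : MeasurableSet {ω | ε < |Y ω|} := measurableSet_lt measurable_const hY.abs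
  have hi : Integrable ({ω | ε < |Y ω|}.indicator fun _ => (1 : ℝ)) P :=
    (integrable_const 1).indicator hD
  calc |∫ ω, Y ω ∂P| ≤ ∫ ω, |Y ω| ∂P := abs_integral_le_integral_abs
    _ ≤ ∫ ω, (ε + {ω | ε < |Y ω|}.indicator (fun _ => (1 : ℝ)) ω) ∂P := by
        refine integral_mono_of_nonneg (ae_of_all _ fun ω => abs_nonneg _)
          ((integrable_const ε).add hi) (ae_of_all _ fun ω => ?_)
        by_cases hω : ε < |Y ω|
        · simp only [Set.indicator, Set.mem_ofPred_eq, hω, if_true]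
          linarith [hY1 ω]
        · simp only [Set.indicator, Set.mem_ofPred_eq, hω, if_false]
          linarith
    _ = ε + P.real {ω | ε < |Y ω|} := by
        rw [integral_add (integrable_const ε) hi, integral_indicator_const _ hD]
        simp

/-- If some block is complete for infinitely many `n`, the constant in the limit of the means is `1`:
the length in the first block is bounded, so convergence in probability gives that of the mean. -/
theorem eq_one_of_meanLimit {P : Measure Ω} [IsProbabilityMeasure P] {l : Fin 2}
    (hgap : ∀ g : ℝ, 0 < g → Tendsto (fun n => P (𝒮.longGap n l g)) atTop (𝓝 0))
    {X : ℕ → (ℕ → ℝ) → ℕ → Ω → ℝ}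
    (hX : ∀ n, 1 ≤ n → ∀ s k ω, X n s k ω = 𝒮.lengthIn l n s k ω) {f : ℝ}
    (hmean : 𝒮.MeanLimit P X f) {s : ℕ → ℝ} (hs : IsAdmissiblePartition s)
    (hq : ∃ᶠ n in atTop, 1 ≤ 𝒮.q s n) : f = 1 := by
  have hs1 : 0 < s 1 := hs.zero ▸ hs.strictMono zero_lt_one
  have hs1' : s 1 ≤ 1 := by have := hs.mesh_le_one 0; rw [hs.zero] at this; simpa using this
  suffices h : |f - 1| * s 1 ≤ 0 by
    have := nonpos_of_mul_nonpos_left h hs1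
    exact sub_eq_zero.1 (abs_nonpos_iff.1 this)
  refine le_of_forall_pos_le_add fun ε hε => ?_
  have hgap' : Tendsto (fun n => P.real (𝒮.longGap n l (ε / 3))) atTop (𝓝 0) :=
    (ENNReal.tendsto_toReal ENNReal.zero_ne_top).comp (hgap (ε / 3) (by positivity))
  obtain ⟨n, hqn, hn, hm, hP⟩ := (hq.and_eventually ((eventually_ge_atTop 1).and
    (((hmean s hs).eventually_le_const (by positivity : (0 : ℝ) < ε / 3)).and
      (hgap'.eventually_le_const (by positivity : (0 : ℝ) < ε / 3))))).exists
  have hk : 1 ∈ Finset.Icc 1 (𝒮.q s n) := Finset.mem_Icc.2 ⟨le_rfl, hqn⟩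
  have h1 := (abs_le_maxAbs _ hk).trans hm
  simp only [hX n hn, Nat.sub_self, hs.zero, sub_zero] at h1
  have hmem : ∀ ω, 𝒮.lengthIn l n s 1 ω ∈ Set.Icc 0 (s 1) := fun ω => by
    simpa [lengthIn, hs.zero] using (𝒮.isSubdivision hn l ω).blockLength_zero_mem_Icc hs1.le
  have hmeas := 𝒮.measurable_lengthIn l hn s 1
  have hint : Integrable (𝒮.lengthIn l n s 1) P :=
    Integrable.of_mem_Icc 0 (s 1) hmeas.aemeasurable (ae_of_all _ hmem)
  have h2 := abs_integral_le_add_measureReal (P := P) (hmeas.sub_const (s 1))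
    (fun ω => abs_le.2 ⟨by linarith [(hmem ω).1], by linarith [(hmem ω).2]⟩)
    (by positivity : (0 : ℝ) ≤ ε / 3)
  have h3 : P.real {ω | ε / 3 < |𝒮.lengthIn l n s 1 ω - s 1|} ≤
      P.real (𝒮.longGap n l (ε / 3)) := by
    refine measureReal_mono fun ω hω => ?_
    by_contra hω'
    have := 𝒮.abs_lengthIn_sub_le hn l hs hk (by positivity) hω'
    rw [Nat.sub_self, hs.zero, sub_zero] at this
    exact absurd hω (not_lt.2 this)
  rw [integral_sub hint (integrable_const _)] at h2
  simp only [integral_const, probReal_univ, smul_eq_mul, one_mul] at h2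
  have h4 : |f - 1| * s 1 = |f * s 1 - s 1| := by
    rw [← abs_of_pos hs1, ← abs_mul, abs_of_pos hs1, sub_mul, one_mul]
  rw [h4]
  have h5 := abs_sub_le (f * s 1) (∫ ω, 𝒮.lengthIn l n s 1 ω ∂P) (s 1)
  rw [abs_sub_comm (f * s 1) (∫ ω, 𝒮.lengthIn l n s 1 ω ∂P)] at h5
  linarith

theorem probLimit_of_meanLimit {P : Measure Ω} [IsProbabilityMeasure P] {l : Fin 2}
    (hgap : ∀ g : ℝ, 0 < g → Tendsto (fun n => P (𝒮.longGap n l g)) atTop (𝓝 0))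
    {X : ℕ → (ℕ → ℝ) → ℕ → Ω → ℝ}
    (hX : ∀ n, 1 ≤ n → ∀ s k ω, X n s k ω = 𝒮.lengthIn l n s k ω) {f : ℝ}
    (hmean : 𝒮.MeanLimit P X f) : 𝒮.ProbLimit P X f := by
  intro s hs
  rw [tendstoInMeasure_iff_norm]
  intro ε hε
  refine tendsto_of_tendsto_of_tendsto_of_le_of_le' tendsto_const_nhds
    (hgap (ε / 2) (by positivity)) (Eventually.of_forall fun _ => zero_le) ?_
  have hf : ∀ᶠ n in atTop, 1 ≤ 𝒮.q s n → f = 1 := by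
    by_cases hq : ∃ᶠ n in atTop, 1 ≤ 𝒮.q s n
    · exact Eventually.of_forall fun _ _ => 𝒮.eq_one_of_meanLimit hgap hX hmean hs hq
    · exact (not_frequently.1 hq).mono fun n hn h => absurd h hn
  filter_upwards [hf, eventually_ge_atTop 1] with n hfn hn
  refine measure_mono fun ω hω => ?_
  by_contra hω'
  have hle : maxAbs (𝒮.q s n) (fun k => X n s k ω - f * (s k - s (k - 1))) ≤ ε / 2 := by
    refine maxAbs_le (by positivity) fun k hk => ?_
    rw [hX n hn, hfn ((Finset.mem_Icc.1 hk).1.trans (Finset.mem_Icc.1 hk).2), one_mul]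
    exact 𝒮.abs_lengthIn_sub_le hn l hs hk (by positivity) hω'
  rw [Set.mem_ofPred_eq, sub_zero, Real.norm_of_nonneg (maxAbs_nonneg _ _)] at hω
  linarith

end SamplingScheme

end NonsyncObs

theorem mainTheorem4 {Ω : Type*} [MeasurableSpace Ω] (P : Measure Ω) [IsProbabilityMeasure P]
    (𝒮 : NonsyncObs.SamplingScheme Ω)
    (κ : ℝ) (hκ : 0 < κ) (hh : Tendsto (fun n : ℕ => (n : ℝ) * 𝒮.h n ^ κ) atTop (𝓝 0))
    (hB1 : ∀ r : ℝ, 0 < r → 𝒮.B1 P r)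
    (hB2 : ∀ r : ℝ, 0 < r → 𝒮.B2 P r)
    (hmix : ∀ r : ℝ, 0 < r → 𝒮.SummableMixing P r)
    (f11 f12 f22 : ℕ → ℝ)
    (hf11 : ∀ p, 0 ≤ f11 p) (hf12 : ∀ p, 0 ≤ f12 p) (hf22 : ∀ p, 0 ≤ f22 p)
    (h11 : ∀ p, 𝒮.MeanLimit P (fun n => 𝒮.form11 n p) (f11 p))
    (h12 : ∀ p, 𝒮.MeanLimit P (fun n => 𝒮.form12 n p) (f12 p))
    (h22 : ∀ p, 𝒮.MeanLimit P (fun n => 𝒮.form22 n p) (f22 p)) :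
    𝒮.A5 P f11 f12 f22 := by
  have hgap := fun (l : Fin 2) (g : ℝ) (hg : 0 < g) =>
    𝒮.tendsto_measure_longGap hκ hh (hB2 κ hκ) l hg
  exact
    { nonneg11 := hf11
      nonneg12 := hf12
      nonneg22 := hf22
      lim11 := fun p => 𝒮.probLimit_of_meanLimit (hgap 0)
        (fun _ hn s k ω => 𝒮.form11_eq hn p s k ω) (h11 p)
      lim12 := fun p => 𝒮.probLimit_of_meanLimit (hgap 0)
        (fun _ hn s k ω => 𝒮.form12_eq hn p s k ω) (h12 p)
      lim22 := fun p => 𝒮.probLimit_of_meanLimit (hgap 1)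
        (fun _ hn s k ω => 𝒮.form22_eq hn p s k ω) (h22 p) }
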